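/- Let $X_1,X_2,\dots$ be independent random variables with common distribution function $F$, let $l_F=\inf\{x:F(x)>0\}$ and $r_F=\sup\{x:F(x)<1\}$, and define upper record times and record values by $L(1)=1$, $L(n)=\min\{j>L(n-1): X_j>X_{L(n-1)}\}$ for $n>1$, and $X(n)=X_{L(n)}$. Let $n,k,r$ be integers with $1\le k\le n-1$ and $r\ge 1$. Let $h$ be a real function that is continuous on $[l_F,r_F]$ (at infinite endpoints no condition is imposed) and whose derivative $h^{(k+r-1)}$ exists and is continuous on $(l_F,r_F)$. For $u\ne v$ put $$M(u,v)=\frac{h(v)-h(u)}{v-u},\qquad {}_iM_j(u,v)=\frac{\partial^{i+j}}{\partial u^i\,\partial v^j}M(u,v).$$ Suppose that $l_F>-\infty$, $r_F=\infty$ and, for some constant $c>0$, $F(x)=1-e^{-c(x-l_F)}$ for all $x\ge l_F$. Then for all $u,v$ with $l_F<u<v<r_F$ $$E\bigl[h^{(k+r-1)}(X(n))\,\big|\,X(n-k)=u,\;X(n+r)=v\bigr]=\frac{(k+r-1)!}{(k-1)!\,(r-1)!}\;{}_{r-1}M_{k-1}(u,v).$$ Here the conditional expectation given the point $(u,v)$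 is the integral of $h^{(k+r-1)}$ with respect to the regular conditional distribution of $X(n)$ given $(X(n-k),X(n+r))$, in its unique version that is weakly continuous in $(u,v)$ on $\{l_F<u<v<r_F\}$; this version exists, and the integral converges absolutely. -/

import Mathlib

open MeasureTheory ProbabilityTheory

noncomputable section

/-- Left extremity `l_F = inf {x : F x > 0}`, in the extended reals. -/
def leftExtremity (F : ℝ → ℝ) : EReal := sInf ((fun x : ℝ => (x : EReal)) '' {x | 0 < F x})

/-- Right extremity `r_F = sup {x : F x < 1}`, in the extended reals. -/
def rightExtremity (F : ℝ → ℝ) : EReal := sSup ((fun x : ℝ => (x : EReal)) '' {x | F x < 1})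

/-- Upper record times. The sequence `x 0, x 1, …` is indexed from `0` (so `x i` is the observation
number `i + 1`), while records are numbered from `1`: the first record is the first observation, and
record number `n + 1` is the first later observation exceeding record number `n`.
(The value at `n = 0` is a placeholder. If no further record exists the infimum of the empty set
is `0`; for i.i.d. samples from a continuous distribution this has probability zero.) -/
def recordTime (x : ℕ → ℝ) : ℕ → ℕ
  | 0 => 0
  | 1 => 0
  | n + 2 => sInf {j | recordTime x (n + 1) < j ∧ x (recordTime x (n + 1)) < x j}

/-- The `n`-th upper record value `X(n)`, `n ≥ 1`, of a random sequence. -/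
def recordValue {Ω : Type*} (X : ℕ → Ω → ℝ) (n : ℕ) (ω : Ω) : ℝ :=
  X (recordTime (fun i => X i ω) n) ω

/-- The divided difference `M(u, v) = (h v - h u) / (v - u)`. -/
def dividedDiff (h : ℝ → ℝ) (u v : ℝ) : ℝ := (h v - h u) / (v - u)

/-- The mixed partial derivative `∂^(i+j) / ∂u^i ∂v^j` of the divided difference of `h`
at `(u, v)`. -/
def dividedDiffDeriv (h : ℝ → ℝ) (i j : ℕ) (u v : ℝ) : ℝ :=
  iteratedDeriv i (fun u' => iteratedDeriv j (fun v' => dividedDiff h u' v') v) u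

/-- `κ` is a regular conditional distribution of `Y` given `Z` which is weakly continuous in the
conditioning value on the set `U`. When the law of `Z` charges every nonempty open subset of an
open set `U`, such a `κ` is uniquely determined at every point of `U`, so that `∫ y, g y ∂(κ z)` is
the meaning of `E[g(Y) | Z = z]` at each single point `z ∈ U`, and not only for almost every `z`. -/
structure IsContinuousCondDistribOn {Ω : Type*} [MeasurableSpace Ω] (Y : Ω → ℝ) (Z : Ω → ℝ × ℝ)
    (κ : Kernel (ℝ × ℝ) ℝ) (U : Set (ℝ × ℝ)) (P : Measure Ω) : Prop where
  isMarkovKernel : IsMarkovKernel κ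
  hasCondDistrib : HasCondDistrib Y Z κ P
  continuousOn : ∀ g : BoundedContinuousFunction ℝ ℝ, ContinuousOn (fun z => ∫ y, g y ∂(κ z)) U

end

open MeasureTheory ProbabilityTheory

/-! For a shifted exponential law the records form a random walk. Given a record at `x`, the next
one has the parent law conditioned to `(x, ∞)`, which by lack of memory is `x` plus an exponential
variable. Hence increments over `j` records are Gamma with shape `j`, independent of the past
(`lintegral_recordValue_add`). Beta-gamma algebra then shows that, given `X(n-k) = u` and `X(n+r) =
v`, the record `X(n)` is distributed as `u + (v - u) S` with `S` of law Beta(`k`, `r`)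
(`lintegral_recordValue_between`).

On the analytic side, `M(u, v)` is the mean of `h'` over the segment from `u` to `v`. Each
derivative in `u` produces a factor `1 - s`, each derivative in `v` a factor `s`, and one more
derivative of `h` (`dividedDiffDeriv_eq_integral`). The resulting weight is the Beta(`k`, `r`)
density up to its normalizing constant, which is the constant of the theorem.

The affine kernel is weakly continuous, and the law of the conditioning pair dominates Lebesgue
measure on `{l < u < v}`. Any other continuous version therefore agrees with it at every point
(`IsContinuousCondDistribOn.apply_eq`). -/

/-! ### Beta-gamma algebra for densities -/

theorem lintegral_comp_affine (f : ℝ → ENNReal) (u : ℝ) {d : ℝ} (hd : 0 < d) :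
    ∫⁻ t, f t = ENNReal.ofReal d * ∫⁻ s, f (u + d * s) := by
  have h1 : ∀ g : ℝ → ENNReal, ∫⁻ s, g (d * s) = ENNReal.ofReal d⁻¹ * ∫⁻ t, g t := by
    intro g
    have : ∫⁻ t, g t ∂(volume.map (d * ·)) = ∫⁻ s, g (d * s) :=
      lintegral_map_equiv g (Homeomorph.mulLeft₀ d hd.ne').toMeasurableEquiv
    rw [← this, Real.map_volume_mul_left hd.ne', lintegral_smul_measure, abs_of_pos (inv_pos.2 hd),
      smul_eq_mul]
  rw [h1 (fun x => f (u + x)), ← mul_assoc, ← ENNReal.ofReal_mul hd.le, mul_inv_cancel₀ hd.ne',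
    ENNReal.ofReal_one, one_mul, lintegral_add_left_eq_self]

/-- The exponentials multiply to one depending on `d` only; the leading factor `d` is the Jacobian
of `t = d * s`. The endpoints are excluded because there `betaPDF` vanishes while a Gamma density of
shape 1 is nonzero at 0. -/
theorem gammaPDF_mul_gammaPDF {a b c d s : ℝ} (ha : 0 < a) (hb : 0 < b) (hc : 0 < c)
    (hd : 0 < d) (hs0 : s ≠ 0) (hs1 : s ≠ 1) :
    ENNReal.ofReal d * (gammaPDF a c (d * s) * gammaPDF b c (d * (1 - s))) =
      gammaPDF (a + b) c d * betaPDF a b s := by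
  rcases lt_or_gt_of_ne hs0 with h0 | h0
  · rw [gammaPDF_of_neg (mul_neg_of_pos_of_neg hd h0), betaPDF_eq_zero_of_nonpos h0.le]; simp
  rcases lt_or_gt_of_ne hs1 with h1 | h1
  swap
  · rw [gammaPDF_of_neg (x := d * (1 - s)) (mul_neg_of_pos_of_neg hd (by linarith)),
      betaPDF_eq_zero_of_one_le h1.le]; simp
  have h1' : 0 < 1 - s := by linarith
  rw [gammaPDF_of_nonneg (by positivity), gammaPDF_of_nonneg (by positivity),
    gammaPDF_of_nonneg hd.le, betaPDF_of_pos_lt_one h0 h1]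
  have := Real.Gamma_pos_of_pos ha
  have := Real.Gamma_pos_of_pos hb
  have := Real.Gamma_pos_of_pos (add_pos ha hb)
  rw [← ENNReal.ofReal_mul (by positivity), ← ENNReal.ofReal_mul (by positivity),
    ← ENNReal.ofReal_mul (by positivity)]
  congr 1
  rw [beta, Real.mul_rpow hd.le h0.le, Real.mul_rpow hd.le h1'.le, Real.rpow_add hc,
    show a + b - 1 = 1 + ((a - 1) + (b - 1)) by ring, Real.rpow_add hd, Real.rpow_add hd,
    Real.rpow_one, show -(c * d) = -(c * (d * s)) + -(c * (d * (1 - s))) by ring, Real.exp_add]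
  field_simp

theorem lintegral_mul_gammaPDF_mul_gammaPDF {a b c : ℝ} (ha : 0 < a) (hb : 0 < b) (hab : 1 < a + b)
    (hc : 0 < c) (u v : ℝ) (q : ℝ → ENNReal) (hq : Measurable q) :
    ∫⁻ t, q t * (gammaPDF a c (t - u) * gammaPDF b c (v - t)) =
      gammaPDF (a + b) c (v - u) * ∫⁻ s, q (u + (v - u) * s) ∂(betaMeasure a b) := by
  rcases lt_or_ge u v with huv | huv
  · have hd : 0 < v - u := by linarith
    have hm : Measurable (betaPDF a b) := by unfold betaPDF; fun_prop
    rw [lintegral_comp_affine _ u hd, betaMeasure, lintegral_withDensity_eq_lintegral_mul _ hm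
      (by fun_prop), ← lintegral_const_mul' _ _ ENNReal.ofReal_ne_top,
      ← lintegral_const_mul' (gammaPDF (a + b) c (v - u)) _ ENNReal.ofReal_ne_top]
    refine lintegral_congr_ae ?_
    filter_upwards [Measure.ae_ne volume 0, Measure.ae_ne volume 1] with s h0 h1
    rw [show u + (v - u) * s - u = (v - u) * s by ring,
      show v - (u + (v - u) * s) = (v - u) * (1 - s) by ring]
    simp only [Pi.mul_apply]
    rw [← mul_assoc (gammaPDF (a + b) c (v - u)), ← gammaPDF_mul_gammaPDF ha hb hc hd h0 h1]
    ring
  · have h0 : gammaPDF (a + b) c (v - u) = 0 := by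
      rcases huv.eq_or_lt with rfl | h
      -- Here `1 < a + b` makes the exponent of 0 nonzero, so the density vanishes.
      · rw [sub_self, gammaPDF_of_nonneg le_rfl, Real.zero_rpow (by linarith)]; simp
      · exact gammaPDF_of_neg (by linarith)
    rw [h0, zero_mul, lintegral_eq_zero_iff' (by unfold gammaPDF; fun_prop)]
    filter_upwards [Measure.ae_ne volume u] with t ht
    rcases lt_or_gt_of_ne ht with h | h
    · simp [gammaPDF_of_neg (show t - u < 0 by linarith)]
    · simp [gammaPDF_of_neg (show v - t < 0 by linarith)]

theorem lintegral_gammaPDF_mul_gammaPDF {a b c : ℝ} (ha : 0 < a) (hb : 0 < b) (hab : 1 < a + b)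
    (hc : 0 < c) (u v : ℝ) :
    ∫⁻ t, gammaPDF a c (t - u) * gammaPDF b c (v - t) = gammaPDF (a + b) c (v - u) := by
  have := isProbabilityMeasureBeta ha hb
  simpa using lintegral_mul_gammaPDF_mul_gammaPDF ha hb hab hc u v 1 measurable_one

/-! ### Record events and the transition law for a general parent distribution -/

/-- The event that record number `m + 1` occurs and is the observation with index `i`. -/
def recordEvent {Ω : Type*} (X : ℕ → Ω → ℝ) : ℕ → ℕ → Set Ω
  | 0, i => {_ω | i = 0}
  | m + 1, j => {ω | ∃ i N, j = i + 1 + N ∧ ω ∈ recordEvent X m i ∧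
      (∀ l < N, X (i + 1 + l) ω ≤ X i ω) ∧ X i ω < X (i + 1 + N) ω}

section
variable {Ω : Type*} {X : ℕ → Ω → ℝ}

/-- On these events every infimum defining the record time is over a nonempty set, so the default
value of `sInf` never enters. -/
theorem recordTime_of_mem_recordEvent {m i : ℕ} {ω : Ω} (h : ω ∈ recordEvent X m i) :
    recordTime (fun i => X i ω) (m + 1) = i := by
  induction m generalizing i with
  | zero => exact (show i = 0 from h).symm
  | succ m ih =>
    obtain ⟨i', N, rfl, hE, hle, hlt⟩ := h
    rw [recordTime, ih hE]
    refine le_antisymm (Nat.sInf_le ⟨by omega, hlt⟩) (le_csInf ⟨_, by omega, hlt⟩ ?_)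
    rintro b ⟨hb, hxb⟩
    by_contra! hcon
    obtain ⟨l, rfl⟩ := Nat.exists_eq_add_of_le (show i' + 1 ≤ b by omega)
    exact absurd hxb (not_lt.2 (hle l (by omega)))

theorem recordValue_of_mem_recordEvent {m i : ℕ} {ω : Ω} (h : ω ∈ recordEvent X m i) :
    recordValue X (m + 1) ω = X i ω := by
  rw [recordValue, recordTime_of_mem_recordEvent h]

theorem pairwise_disjoint_recordEvent (m : ℕ) :
    Pairwise (Function.onFun Disjoint (recordEvent X m)) := by
  intro i j hij
  refine Set.disjoint_left.2 fun ω hi hj => hij ?_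
  rw [← recordTime_of_mem_recordEvent hi, recordTime_of_mem_recordEvent hj]

/-- The event that the record at index `i` is followed by `N` observations which are not records. -/
def noRecord (X : ℕ → Ω → ℝ) (i N : ℕ) : Set Ω := {ω | ∀ l < N, X (i + 1 + l) ω ≤ X i ω}

variable [MeasurableSpace Ω]

/-- The information contained in the observations up to index `i`. -/
abbrev past (hX : ∀ i, Measurable (X i)) : Filtration ℕ (inferInstance : MeasurableSpace Ω) :=
  Filtration.natural X (fun i => (hX i).stronglyMeasurable)

theorem measurable_past (hX : ∀ i, Measurable (X i)) {i j : ℕ} (hij : i ≤ j) :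
    Measurable[past hX j] (X i) :=
  ((Filtration.stronglyAdapted_natural (fun i => (hX i).stronglyMeasurable)) i).measurable.mono
    ((past hX).mono hij) le_rfl

theorem measurableSet_noRecord_past (hX : ∀ i, Measurable (X i)) (i N : ℕ) :
    MeasurableSet[past hX (i + N)] (noRecord X i N) := by
  have : noRecord X i N = ⋂ l, ⋂ (_ : l < N), {ω | X (i + 1 + l) ω ≤ X i ω} := by
    ext; simp [noRecord]
  rw [this]
  exact MeasurableSet.iInter fun l => MeasurableSet.iInter fun hl =>
    (measurable_past hX (by omega)).prodMk (measurable_past hX (by omega))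
      (measurableSet_le measurable_fst measurable_snd)

theorem measurableSet_recordEvent_past (hX : ∀ i, Measurable (X i)) (m i : ℕ) :
    MeasurableSet[past hX i] (recordEvent X m i) := by
  induction m generalizing i with
  | zero => exact MeasurableSet.const _
  | succ m ih =>
    have : recordEvent X (m + 1) i = ⋃ j, ⋃ N, ⋃ (_ : i = j + 1 + N),
        (recordEvent X m j ∩ (noRecord X j N ∩ {ω | X j ω < X (j + 1 + N) ω})) := by
      ext ω
      simp only [Set.mem_iUnion, exists_prop]
      exact Iff.rfl
    rw [this]
    refine MeasurableSet.iUnion fun j => MeasurableSet.iUnion fun N => MeasurableSet.iUnion ?_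
    rintro rfl
    exact ((past hX).mono (by omega : j ≤ _) _ (ih j)).inter
      (((past hX).mono (by omega : j + N ≤ _) _ (measurableSet_noRecord_past hX j N)).inter
        ((measurable_past hX (by omega)).prodMk (measurable_past hX (by omega))
          (measurableSet_lt measurable_fst measurable_snd)))

theorem measurableSet_recordEvent (hX : ∀ i, Measurable (X i)) (m i : ℕ) :
    MeasurableSet (recordEvent X m i) :=
  (past hX).le i _ (measurableSet_recordEvent_past hX m i)

/-- `Y` is determined by the observations up to and including record number `m + 1`. -/
def IsRecordPast {α : Type*} [MeasurableSpace α] (hX : ∀ i, Measurable (X i)) (m : ℕ)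
    (Y : Ω → α) : Prop :=
  ∀ i, ∃ Z : Ω → α, Measurable[past hX i] Z ∧ ∀ ω ∈ recordEvent X m i, Y ω = Z ω

theorem isRecordPast_recordValue (hX : ∀ i, Measurable (X i)) (m : ℕ) :
    IsRecordPast hX m (recordValue X (m + 1)) :=
  fun i => ⟨X i, measurable_past hX le_rfl, fun _ => recordValue_of_mem_recordEvent⟩

theorem IsRecordPast.const {α : Type*} [MeasurableSpace α] (hX : ∀ i, Measurable (X i)) (m : ℕ)
    (a : α) : IsRecordPast hX m (fun _ => a) :=
  fun _ => ⟨_, measurable_const, fun _ _ => rfl⟩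

theorem IsRecordPast.prodMk {α β : Type*} [MeasurableSpace α] [MeasurableSpace β]
    {hX : ∀ i, Measurable (X i)} {m : ℕ} {Y : Ω → α} {Y' : Ω → β} (h : IsRecordPast hX m Y)
    (h' : IsRecordPast hX m Y') : IsRecordPast hX m (fun ω => (Y ω, Y' ω)) := by
  intro i
  obtain ⟨Z, hZ, hE⟩ := h i
  obtain ⟨Z', hZ', hE'⟩ := h' i
  exact ⟨fun ω => (Z ω, Z' ω), hZ.prodMk hZ', fun ω hω => Prod.ext (hE ω hω) (hE' ω hω)⟩

/-- If the next record has index `j`, the current one has some index `i < j`. The finitely many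
representatives `Z i` with `i < j` can thus be pasted along the disjoint record events, all of which
are known at time `j`. -/
theorem IsRecordPast.succ {α : Type*} [MeasurableSpace α]
    {hX : ∀ i, Measurable (X i)} {m : ℕ} {Y : Ω → α} (h : IsRecordPast hX m Y) :
    IsRecordPast hX (m + 1) Y := by
  classical
  intro j
  choose Z hZ hE using h
  cases isEmpty_or_nonempty Ω
  · exact ⟨Y, @measurable_of_empty _ _ (past hX j) _ _ _, fun ω _ => rfl⟩
  have ω₀ : Ω := Classical.arbitrary Ω
  have glue : ∀ n ≤ j, ∃ W : Ω → α, Measurable[past hX j] W ∧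
      ∀ i < n, ∀ ω ∈ recordEvent X m i, Y ω = W ω := by
    intro n
    induction n with
    | zero => exact fun _ => ⟨fun _ => Y ω₀, measurable_const, fun i hi => absurd hi (by omega)⟩
    | succ n ih =>
      intro hn
      obtain ⟨W, hW, hEW⟩ := ih (by omega)
      refine ⟨(recordEvent X m n).piecewise (Z n) W, ?_, ?_⟩
      · exact Measurable.piecewise
          ((past hX).mono (by omega : n ≤ j) _ (measurableSet_recordEvent_past hX m n))
          ((hZ n).mono ((past hX).mono (by omega)) le_rfl) hW
      · intro i hi ω hω
        by_cases h' : ω ∈ recordEvent X m n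
        · rw [Set.piecewise_eq_of_mem _ _ _ h', hE n ω h']
        · rw [Set.piecewise_eq_of_notMem _ _ _ h']
          refine hEW i ?_ ω hω
          rcases Nat.lt_succ_iff_lt_or_eq.1 hi with h | rfl
          · exact h
          · exact absurd hω h'
  obtain ⟨W, hW, hEW⟩ := glue j le_rfl
  refine ⟨W, hW, ?_⟩
  rintro ω ⟨i, N, rfl, hω, -⟩
  exact hEW i (by omega) ω hω

theorem IsRecordPast.mono {α : Type*} [MeasurableSpace α]
    {hX : ∀ i, Measurable (X i)} {m : ℕ} {Y : Ω → α} (h : IsRecordPast hX m Y) (j : ℕ) :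
    IsRecordPast hX (m + j) Y := by
  induction j with
  | zero => exact h
  | succ j ih => exact ih.succ

variable {P : Measure Ω} [IsProbabilityMeasure P] {ν : Measure ℝ}

/-- `X j` is independent of the strictly earlier observations, so it can be integrated out with the
past frozen. -/
theorem lintegral_past_prod {β : Type*} [MeasurableSpace β] (hX : ∀ i, Measurable (X i))
    (hindep : iIndepFun X P) (hν : ∀ i, P.map (X i) = ν) {i j : ℕ} (hij : i < j) {Z : Ω → β}
    (hZ : Measurable[past hX i] Z) {φ : β × ℝ → ENNReal} (hφ : Measurable φ) :
    ∫⁻ ω, φ (Z ω, X j ω) ∂P = ∫⁻ ω, ∫⁻ y, φ (Z ω, y) ∂ν ∂P := by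
  have hZ' : Measurable Z := hZ.mono ((past hX).le i) le_rfl
  have : IsProbabilityMeasure ν := hν 0 ▸ Measure.isProbabilityMeasure_map (hX 0).aemeasurable
  have hI : IndepFun Z (X j) P := by
    have h1 := hindep.indep_comap_natural_of_lt (fun i => (hX i).stronglyMeasurable) hij
    rw [IndepFun_iff_Indep]
    exact indep_of_indep_of_le_left h1.symm hZ.comap_le
  have := (indepFun_iff_map_prod_eq_prod_map_map hZ'.aemeasurable (hX j).aemeasurable).1 hI
  rw [hν] at this
  rw [← lintegral_map (f := φ) (g := fun ω => (Z ω, X j ω)) hφ (hZ'.prodMk (hX j)), this,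
    lintegral_prod _ hφ.aemeasurable, lintegral_map hφ.lintegral_prod_right' hZ']

theorem measurable_measure_Iic (ν : Measure ℝ) : Measurable (fun x : ℝ => ν (Set.Iic x)) :=
  (show Monotone fun x : ℝ => ν (Set.Iic x) from
    fun _ _ hxy => measure_mono (Set.Iic_subset_Iic.2 hxy)).measurable

/-- Given `X i = x`, each later observation stays below `x` with probability `ν (Set.Iic x)`. The
induction integrates out the last observation and absorbs the resulting factor into `ψ`, which is
why `ψ` is general. -/
theorem lintegral_noRecord (hX : ∀ i, Measurable (X i))
    (hindep : iIndepFun X P) (hν : ∀ i, P.map (X i) = ν) (i N : ℕ) {ψ : Ω → ENNReal}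
    (hψ : Measurable[past hX i] ψ) :
    ∫⁻ ω in noRecord X i N, ψ ω ∂P = ∫⁻ ω, ν (Set.Iic (X i ω)) ^ N * ψ ω ∂P := by
  have : IsProbabilityMeasure ν := hν 0 ▸ Measure.isProbabilityMeasure_map (hX 0).aemeasurable
  induction N generalizing ψ with
  | zero => simp [noRecord]
  | succ N ih =>
    have hS : MeasurableSet (noRecord X i N) :=
      (past hX).le _ _ (measurableSet_noRecord_past hX i N)
    have hS' : MeasurableSet (noRecord X i (N + 1)) :=
      (past hX).le _ _ (measurableSet_noRecord_past hX i (N + 1))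
    have hle : MeasurableSet {p : (ENNReal × ℝ) × ℝ | p.2 ≤ p.1.2} :=
      measurableSet_le measurable_snd measurable_fst.snd
    have key := lintegral_past_prod hX hindep hν (show i + N < i + 1 + N by omega)
      (Z := fun ω => ((noRecord X i N).indicator ψ ω, X i ω))
      (((hψ.mono ((past hX).mono (by omega)) le_rfl).indicator
        (measurableSet_noRecord_past hX i N)).prodMk (measurable_past hX (by omega)))
      (φ := {p : (ENNReal × ℝ) × ℝ | p.2 ≤ p.1.2}.indicator fun p => p.1.1)
      (measurable_fst.fst.indicator hle)
    have e1 : ∀ ω, {p : (ENNReal × ℝ) × ℝ | p.2 ≤ p.1.2}.indicator (fun p => p.1.1)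
        (((noRecord X i N).indicator ψ ω, X i ω), X (i + 1 + N) ω) =
        (noRecord X i (N + 1)).indicator ψ ω := by
      intro ω
      have : ω ∈ noRecord X i (N + 1) ↔ ω ∈ noRecord X i N ∧ X (i + 1 + N) ω ≤ X i ω := by
        simp only [noRecord, Set.mem_ofPred_eq, Nat.lt_succ_iff_lt_or_eq]
        constructor
        · exact fun h => ⟨fun l hl => h l (Or.inl hl), h N (Or.inr rfl)⟩
        · rintro ⟨h, h'⟩ l (hl | rfl)
          exacts [h l hl, h']
      by_cases h1 : ω ∈ noRecord X i N <;> by_cases h2 : X (i + 1 + N) ω ≤ X i ω <;>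
        simp [Set.indicator, this, h1, h2]
    have e2 : ∀ ω, ∫⁻ y, {p : (ENNReal × ℝ) × ℝ | p.2 ≤ p.1.2}.indicator (fun p => p.1.1)
        (((noRecord X i N).indicator ψ ω, X i ω), y) ∂ν =
        (noRecord X i N).indicator (fun ω => ν (Set.Iic (X i ω)) * ψ ω) ω := by
      intro ω
      have : ∀ y, {p : (ENNReal × ℝ) × ℝ | p.2 ≤ p.1.2}.indicator (fun p => p.1.1)
        (((noRecord X i N).indicator ψ ω, X i ω), y) =
        (Set.Iic (X i ω)).indicator (fun _ => (noRecord X i N).indicator ψ ω) y := fun y => rfl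
      simp_rw [this]
      rw [lintegral_indicator measurableSet_Iic]
      by_cases h1 : ω ∈ noRecord X i N <;> simp [h1, mul_comm]
    simp_rw [e1, e2] at key
    rw [lintegral_indicator hS, lintegral_indicator hS', ih] at key
    · rw [key]; simp_rw [pow_succ, mul_assoc]
    · exact ((measurable_measure_Iic ν).comp (measurable_past hX le_rfl)).mul hψ

theorem measurable_indicator_lt {α : Type*} [MeasurableSpace α] {φ : α × ℝ → ENNReal}
    (hφ : Measurable φ) :
    Measurable ({q : (α × ℝ) × ℝ | q.1.2 < q.2}.indicator fun q => φ (q.1.1, q.2)) :=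
  (hφ.comp (measurable_fst.fst.prodMk measurable_snd)).indicator
    (measurableSet_lt measurable_fst.snd measurable_snd)

theorem measurable_setLIntegral_Ioi {α : Type*} [MeasurableSpace α] (ν : Measure ℝ) [SFinite ν]
    {φ : α × ℝ → ENNReal} (hφ : Measurable φ) :
    Measurable fun q : α × ℝ => ∫⁻ y in Set.Ioi q.2, φ (q.1, y) ∂ν := by
  convert (measurable_indicator_lt hφ).lintegral_prod_right' (ν := ν) using 2 with q
  rw [← lintegral_indicator measurableSet_Ioi]
  rfl

theorem setLIntegral_next_record {α : Type*} [MeasurableSpace α] (hX : ∀ i, Measurable (X i))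
    (hindep : iIndepFun X P) (hν : ∀ i, P.map (X i) = ν) (m i N : ℕ) {Z : Ω → α}
    (hZ : Measurable[past hX i] Z) {φ : α × ℝ → ENNReal} (hφ : Measurable φ) :
    ∫⁻ ω in recordEvent X m i ∩ (noRecord X i N ∩ {ω | X i ω < X (i + 1 + N) ω}),
        φ (Z ω, X (i + 1 + N) ω) ∂P =
      ∫⁻ ω in recordEvent X m i, ν (Set.Iic (X i ω)) ^ N *
        ∫⁻ y in Set.Ioi (X i ω), φ (Z ω, y) ∂ν ∂P := by
  have : IsProbabilityMeasure ν := hν 0 ▸ Measure.isProbabilityMeasure_map (hX 0).aemeasurable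
  have hφ' := measurable_indicator_lt hφ
  set D : Set Ω := recordEvent X m i ∩ (noRecord X i N ∩ {ω | X i ω < X (i + 1 + N) ω})
  have hEm := measurableSet_recordEvent_past hX m i
  have hSm := measurableSet_noRecord_past hX i N
  have hEm' := measurableSet_recordEvent hX m i
  have hSm' := (past hX).le _ _ hSm
  have hDm : MeasurableSet D := hEm'.inter (hSm'.inter (measurableSet_lt (hX _) (hX _)))
  have key := lintegral_past_prod hX hindep hν (show i + N < i + 1 + N by omega)
    (Z := fun ω => ((recordEvent X m i ∩ noRecord X i N).indicator (1 : Ω → ENNReal) ω,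
      (Z ω, X i ω)))
    (((@measurable_const _ _ _ (past hX (i + N)) (1 : ENNReal)).indicator
      (((past hX).mono (by omega : i ≤ i + N) _ hEm).inter hSm)).prodMk
      ((hZ.mono ((past hX).mono (by omega)) le_rfl).prodMk (measurable_past hX (by omega))))
    (φ := fun q : (ENNReal × (α × ℝ)) × ℝ => q.1.1 *
      ({q : (α × ℝ) × ℝ | q.1.2 < q.2}.indicator fun q => φ (q.1.1, q.2)) (q.1.2, q.2))
    (measurable_fst.fst.mul (hφ'.comp (measurable_fst.snd.prodMk measurable_snd)))
  have e1 : ∫⁻ ω in D, φ (Z ω, X (i + 1 + N) ω) ∂P =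
      ∫⁻ ω, (recordEvent X m i ∩ noRecord X i N).indicator (1 : Ω → ENNReal) ω *
      ({q : (α × ℝ) × ℝ | q.1.2 < q.2}.indicator fun q => φ (q.1.1, q.2))
        ((Z ω, X i ω), X (i + 1 + N) ω) ∂P := by
    rw [← lintegral_indicator hDm]
    refine lintegral_congr fun ω => ?_
    by_cases h : ω ∈ D
    · rw [Set.indicator_of_mem h,
        Set.indicator_of_mem (show ω ∈ recordEvent X m i ∩ noRecord X i N from ⟨h.1, h.2.1⟩),
        Set.indicator_of_mem (show _ ∈ {q : (α × ℝ) × ℝ | q.1.2 < q.2} from h.2.2)]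
      simp
    · rw [Set.indicator_of_notMem h]
      by_cases h' : ω ∈ recordEvent X m i ∩ noRecord X i N
      · rw [Set.indicator_of_notMem (s := {q : (α × ℝ) × ℝ | q.1.2 < q.2}), mul_zero]
        exact fun h3 => h ⟨h'.1, h'.2, h3⟩
      · rw [Set.indicator_of_notMem h', zero_mul]
  have e2 : ∀ ω, ∫⁻ y, (recordEvent X m i ∩ noRecord X i N).indicator (1 : Ω → ENNReal) ω *
      ({q : (α × ℝ) × ℝ | q.1.2 < q.2}.indicator fun q => φ (q.1.1, q.2))
        ((Z ω, X i ω), y) ∂ν = (noRecord X i N).indicator ((recordEvent X m i).indicator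
        fun ω => ∫⁻ y in Set.Ioi (X i ω), φ (Z ω, y) ∂ν) ω := by
    intro ω
    have : ∫⁻ y, ({q : (α × ℝ) × ℝ | q.1.2 < q.2}.indicator fun q => φ (q.1.1, q.2))
        ((Z ω, X i ω), y) ∂ν = ∫⁻ y in Set.Ioi (X i ω), φ (Z ω, y) ∂ν := by
      rw [← lintegral_indicator measurableSet_Ioi]; rfl
    rw [lintegral_const_mul' _ _ (by by_cases h : ω ∈ recordEvent X m i ∩ noRecord X i N <;>
      simp [h]), this]
    by_cases h1 : ω ∈ noRecord X i N <;> by_cases h2 : ω ∈ recordEvent X m i <;>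
      simp [h1, h2]
  simp_rw [e2] at key
  rw [e1, key, lintegral_indicator hSm', lintegral_noRecord hX hindep hν,
    ← lintegral_indicator hEm']
  · refine lintegral_congr fun ω => ?_
    by_cases h2 : ω ∈ recordEvent X m i <;> simp [h2]
  · exact ((measurable_setLIntegral_Ioi ν hφ).comp
      (hZ.prodMk (measurable_past hX le_rfl))).indicator hEm

/-- The event is split by the index `i` of the current record and the number `N` of non-records
after it. Summing the geometric series in `N` yields the inverse tail probability, hence `ν`
conditioned to lie above the current record. -/
theorem lintegral_recordEvent_succ {α : Type*} [MeasurableSpace α] (hX : ∀ i, Measurable (X i))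
    (hindep : iIndepFun X P) (hν : ∀ i, P.map (X i) = ν) (m : ℕ) {Y : Ω → α}
    (hY : IsRecordPast hX m Y) {φ : α × ℝ → ENNReal} (hφ : Measurable φ) :
    ∫⁻ ω in ⋃ j, recordEvent X (m + 1) j, φ (Y ω, recordValue X (m + 2) ω) ∂P =
      ∫⁻ ω in ⋃ i, recordEvent X m i, (1 - ν (Set.Iic (recordValue X (m + 1) ω)))⁻¹ *
        ∫⁻ y in Set.Ioi (recordValue X (m + 1) ω), φ (Y ω, y) ∂ν ∂P := by
  have : IsProbabilityMeasure ν := hν 0 ▸ Measure.isProbabilityMeasure_map (hX 0).aemeasurable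
  choose Z hZ hE using hY
  set D : ℕ × ℕ → Set Ω := fun p =>
    recordEvent X m p.1 ∩ (noRecord X p.1 p.2 ∩ {ω | X p.1 ω < X (p.1 + 1 + p.2) ω})
  have hDE : ∀ p, D p ⊆ recordEvent X (m + 1) (p.1 + 1 + p.2) :=
    fun p ω hω => ⟨p.1, p.2, rfl, hω.1, hω.2.1, hω.2.2⟩
  have hU : ⋃ j, recordEvent X (m + 1) j = ⋃ p, D p := by
    ext ω
    simp only [Set.mem_iUnion]
    constructor
    · rintro ⟨j, i, N, rfl, h1, h2, h3⟩
      exact ⟨(i, N), h1, h2, h3⟩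
    · rintro ⟨p, hp⟩
      exact ⟨_, hDE p hp⟩
  have hDm : ∀ p, MeasurableSet (D p) := fun p =>
    (measurableSet_recordEvent hX _ _).inter
      (((past hX).le _ _ (measurableSet_noRecord_past hX _ _)).inter
        (measurableSet_lt (hX _) (hX _)))
  have hDd : Pairwise (Function.onFun Disjoint D) := by
    rintro ⟨i, N⟩ ⟨i', N'⟩ hne
    refine Set.disjoint_left.2 fun ω h h' => hne ?_
    have h1 := (recordTime_of_mem_recordEvent h.1).symm.trans (recordTime_of_mem_recordEvent h'.1)
    have h2 := (recordTime_of_mem_recordEvent (hDE _ h)).symm.trans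
      (recordTime_of_mem_recordEvent (hDE _ h'))
    simp only at h1 h2
    ext <;> simp only <;> omega
  have step : ∀ i N, ∫⁻ ω in D (i, N), φ (Y ω, recordValue X (m + 2) ω) ∂P =
      ∫⁻ ω in recordEvent X m i, ν (Set.Iic (X i ω)) ^ N *
        ∫⁻ y in Set.Ioi (X i ω), φ (Z i ω, y) ∂ν ∂P := by
    intro i N
    rw [← setLIntegral_next_record hX hindep hν m i N (hZ i) hφ]
    refine setLIntegral_congr_fun (hDm _) fun ω h => ?_
    simp only [recordValue_of_mem_recordEvent (hDE _ h), hE i ω h.1]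
  have hsum := lintegral_iUnion (μ := P) hDm hDd fun ω => φ (Y ω, recordValue X (m + 2) ω)
  rw [ENNReal.tsum_prod'] at hsum
  rw [hU, hsum,
    lintegral_iUnion (measurableSet_recordEvent hX m) (pairwise_disjoint_recordEvent m)]
  refine tsum_congr fun i => ?_
  simp_rw [step]
  have hEm' := measurableSet_recordEvent hX m i
  have hZ' : Measurable (Z i) := (hZ i).mono ((past hX).le i) le_rfl
  have hmeas : ∀ N, AEMeasurable (fun ω => ν (Set.Iic (X i ω)) ^ N *
      ∫⁻ y in Set.Ioi (X i ω), φ (Z i ω, y) ∂ν) (P.restrict (recordEvent X m i)) := fun N =>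
    ((((measurable_measure_Iic ν).comp (hX i)).pow_const N).mul
      ((measurable_setLIntegral_Ioi ν hφ).comp (hZ'.prodMk (hX i)))).aemeasurable
  rw [← lintegral_tsum hmeas]
  refine setLIntegral_congr_fun hEm' fun ω h2 => ?_
  simp only [recordValue_of_mem_recordEvent h2, hE i ω h2, ENNReal.tsum_mul_right,
    ENNReal.tsum_geometric]
end

/-! ### The shifted exponential law and its lack of memory -/

@[fun_prop]
theorem measurable_gammaPDF (a c : ℝ) : Measurable (gammaPDF a c) := by
  unfold gammaPDF; fun_prop

theorem lintegral_mul_mul_gammaPDF (f g : ℝ → ENNReal) (a c x : ℝ) :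
    (∫⁻ y, f y * g y) * gammaPDF a c x = ∫⁻ y, f y * (gammaPDF a c x * g y) := by
  rw [← lintegral_mul_const' (gammaPDF a c x) _ ENNReal.ofReal_ne_top]
  exact lintegral_congr fun y => by ring

theorem setLIntegral_Iic_exponentialPDF_sub {l c : ℝ} (hc : 0 < c) (x : ℝ) :
    ∫⁻ y in Set.Iic x, gammaPDF 1 c (y - l) =
      ENNReal.ofReal (if l ≤ x then 1 - Real.exp (-c * (x - l)) else 0) := by
  have h1 := lintegral_exponentialPDF_eq_antiDeriv hc (x - l)
  simp only [sub_nonneg, ← neg_mul] at h1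
  rw [← h1, ← lintegral_indicator measurableSet_Iic, ← lintegral_indicator measurableSet_Iic,
    ← lintegral_sub_right_eq_self (Set.indicator (Set.Iic (x - l)) _) l]
  refine lintegral_congr fun y => ?_
  simp only [Set.indicator, Set.mem_Iic, sub_le_sub_iff_right]
  rfl

/-- The formula gives distribution function 0 at `l`, and monotonicity forces 0 below it. -/
theorem eq_withDensity_of_cdf_eq {ν : Measure ℝ} [IsProbabilityMeasure ν] {l c : ℝ} (hc : 0 < c)
    (h : ∀ x, l ≤ x → cdf ν x = 1 - Real.exp (-c * (x - l))) :
    ν = volume.withDensity (fun y => gammaPDF 1 c (y - l)) := by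
  refine Measure.ext_of_Iic _ _ fun x => ?_
  rw [withDensity_apply _ measurableSet_Iic, setLIntegral_Iic_exponentialPDF_sub hc]
  split_ifs with hx
  · rw [← h x hx, ofReal_cdf]
  · have h0 : ν (Set.Iic l) = 0 := by rw [← ofReal_cdf, h l le_rfl]; simp
    rw [ENNReal.ofReal_zero]
    exact measure_mono_null (Set.Iic_subset_Iic.2 (not_le.1 hx).le) h0

theorem inv_mul_setLIntegral_Ioi {ν : Measure ℝ} {l c : ℝ} (hc : 0 < c)
    (hν : ν = volume.withDensity (fun y => gammaPDF 1 c (y - l))) {x : ℝ} (hx : l ≤ x)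
    {g : ℝ → ENNReal} (hg : Measurable g) :
    (1 - ν (Set.Iic x))⁻¹ * ∫⁻ y in Set.Ioi x, g y ∂ν = ∫⁻ y, g y * gammaPDF 1 c (y - x) := by
  have hexp := Real.exp_pos (-c * (x - l))
  have h1 : 1 - ν (Set.Iic x) = ENNReal.ofReal (Real.exp (-c * (x - l))) := by
    have hle : Real.exp (-c * (x - l)) ≤ 1 := Real.exp_le_one_iff.2 (by nlinarith)
    rw [hν, withDensity_apply _ measurableSet_Iic, setLIntegral_Iic_exponentialPDF_sub hc, if_pos hx,
      ← ENNReal.ofReal_one, ← ENNReal.ofReal_sub _ (by linarith), sub_sub_cancel]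
  rw [h1, hν, setLIntegral_withDensity_eq_setLIntegral_mul _ (by fun_prop) hg measurableSet_Ioi]
  have h2 : ∫⁻ y in Set.Ioi x, ((fun y => gammaPDF 1 c (y - l)) * g) y =
      ∫⁻ y in Set.Ioi x,
        ENNReal.ofReal (Real.exp (-c * (x - l))) * (g y * gammaPDF 1 c (y - x)) := by
    refine setLIntegral_congr_fun measurableSet_Ioi fun y hy => ?_
    have hy' : x < y := hy
    simp only [Pi.mul_apply]
    rw [gammaPDF_of_nonneg (by linarith), gammaPDF_of_nonneg (by linarith), mul_comm, mul_left_comm,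
      ← ENNReal.ofReal_mul hexp.le]
    congr 2
    -- Lack of memory: the tail factor at `x` splits off and cancels against the normalization.
    rw [show -(c * (y - l)) = -c * (x - l) + -(c * (y - x)) by ring, Real.exp_add]
    simp
    ring
  rw [h2, lintegral_const_mul' _ _ ENNReal.ofReal_ne_top, ← mul_assoc, ENNReal.inv_mul_cancel
    (by simpa using hexp) ENNReal.ofReal_ne_top, one_mul, ← lintegral_indicator measurableSet_Ioi]
  refine lintegral_congr_ae ?_
  filter_upwards [Measure.ae_ne volume x] with y hy
  rcases lt_or_gt_of_ne hy with h | h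
  · rw [gammaPDF_of_neg (by linarith), Set.indicator_of_notMem (by simpa using h.le), mul_zero]
  · rw [Set.indicator_of_mem (by simpa using h)]

/-! ### Records as a random walk with Gamma increments -/

section
variable {Ω : Type*} [MeasurableSpace Ω] {P : Measure Ω} {X : ℕ → Ω → ℝ} {l c : ℝ}

theorem ae_le_recordValue (hX : ∀ i, Measurable (X i))
    (hν : ∀ i, P.map (X i) = volume.withDensity (fun y => gammaPDF 1 c (y - l))) (m : ℕ) :
    ∀ᵐ ω ∂P, l ≤ recordValue X m ω := by
  have : ∀ i, ∀ᵐ ω ∂P, l ≤ X i ω := by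
    intro i
    refine ae_of_ae_map (p := fun y => l ≤ y) (hX i).aemeasurable ?_
    rw [hν, ae_withDensity_iff (by fun_prop)]
    refine Filter.Eventually.of_forall fun y hy => ?_
    by_contra! hlt
    exact hy (gammaPDF_of_neg (by linarith))
  filter_upwards [ae_all_iff.2 this] with ω hω
  exact hω _

variable [IsProbabilityMeasure P]

theorem setLIntegral_recordEvent_succ {α : Type*} [MeasurableSpace α] (hX : ∀ i, Measurable (X i))
    (hindep : iIndepFun X P) (hc : 0 < c)
    (hν : ∀ i, P.map (X i) = volume.withDensity (fun y => gammaPDF 1 c (y - l))) {m : ℕ}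
    {Y : Ω → α} (hY : IsRecordPast hX m Y) {φ : α × ℝ → ENNReal} (hφ : Measurable φ) :
    ∫⁻ ω in ⋃ j, recordEvent X (m + 1) j, φ (Y ω, recordValue X (m + 2) ω) ∂P =
      ∫⁻ ω in ⋃ i, recordEvent X m i,
        (∫⁻ y, φ (Y ω, y) * gammaPDF 1 c (y - recordValue X (m + 1) ω)) ∂P := by
  rw [lintegral_recordEvent_succ hX hindep hν m hY hφ]
  refine lintegral_congr_ae (ae_restrict_of_ae ?_)
  filter_upwards [ae_le_recordValue hX hν (m + 1)] with ω hω
  exact inv_mul_setLIntegral_Ioi hc rfl hω (hφ.comp measurable_prodMk_left)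

theorem lintegral_gammaPDF_sub {a : ℝ} (ha : 0 < a) (hc : 0 < c) (x : ℝ) :
    ∫⁻ y, gammaPDF a c (y - x) = 1 := by
  rw [lintegral_sub_right_eq_self, lintegral_gammaPDF_eq_one ha hc]

/-- With `φ = 1` the transition formula preserves mass, since the exponential density integrates to
1; so each record exists almost surely. -/
theorem ae_recordEvent (hX : ∀ i, Measurable (X i)) (hindep : iIndepFun X P) (hc : 0 < c)
    (hν : ∀ i, P.map (X i) = volume.withDensity (fun y => gammaPDF 1 c (y - l))) (m : ℕ) :
    ∀ᵐ ω ∂P, ω ∈ ⋃ i, recordEvent X m i := by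
  have hm : ∀ m, MeasurableSet (⋃ i, recordEvent X m i) := fun m =>
    MeasurableSet.iUnion (measurableSet_recordEvent hX m)
  suffices P (⋃ i, recordEvent X m i) = 1 from
    (mem_ae_iff_prob_eq_one (hm m)).2 this
  induction m with
  | zero =>
    convert measure_univ (μ := P)
    exact Set.eq_univ_of_forall fun ω => Set.mem_iUnion.2 ⟨0, rfl⟩
  | succ m ih =>
    have := setLIntegral_recordEvent_succ hX hindep hc hν (IsRecordPast.const hX m ())
      (φ := fun _ => 1) measurable_const
    simp only [one_mul, lintegral_gammaPDF_sub one_pos hc] at this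
    simpa [ih] using this

theorem aemeasurable_recordValue (hX : ∀ i, Measurable (X i)) (hindep : iIndepFun X P)
    (hc : 0 < c) (hν : ∀ i, P.map (X i) = volume.withDensity (fun y => gammaPDF 1 c (y - l)))
    (m : ℕ) : AEMeasurable (recordValue X (m + 1)) P := by
  rw [← Measure.restrict_eq_self_of_ae_mem (ae_recordEvent hX hindep hc hν m),
    aemeasurable_iUnion_iff]
  intro i
  refine (hX i).aemeasurable.congr ?_
  filter_upwards [ae_restrict_mem (measurableSet_recordEvent hX m i)] with ω hω
  exact (recordValue_of_mem_recordEvent hω).symm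

theorem measurable_lintegral_gammaPDF {α : Type*} [MeasurableSpace α] {φ : α × ℝ → ENNReal}
    (hφ : Measurable φ) (a : ℝ) :
    Measurable fun p : α × ℝ => ∫⁻ y, φ (p.1, y) * gammaPDF a c (y - p.2) :=
  Measurable.lintegral_prod_right' (f := fun q : (α × ℝ) × ℝ =>
    φ (q.1.1, q.2) * gammaPDF a c (q.2 - q.1.2)) (by fun_prop)

/-- The increment over `j` records is Gamma distributed and independent of the past. -/
theorem lintegral_recordValue_add {α : Type*} [MeasurableSpace α] (hX : ∀ i, Measurable (X i))
    (hindep : iIndepFun X P) (hc : 0 < c)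
    (hν : ∀ i, P.map (X i) = volume.withDensity (fun y => gammaPDF 1 c (y - l))) {m : ℕ}
    {Y : Ω → α} (hY : IsRecordPast hX m Y) {j : ℕ} (hj : 1 ≤ j) {φ : α × ℝ → ENNReal}
    (hφ : Measurable φ) :
    ∫⁻ ω, φ (Y ω, recordValue X (m + 1 + j) ω) ∂P =
      ∫⁻ ω, (∫⁻ y, φ (Y ω, y) * gammaPDF j c (y - recordValue X (m + 1) ω)) ∂P := by
  have one : ∀ {m : ℕ}, IsRecordPast hX m Y → ∀ {φ : α × ℝ → ENNReal}, Measurable φ →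
      ∫⁻ ω, φ (Y ω, recordValue X (m + 1 + 1) ω) ∂P =
      ∫⁻ ω, (∫⁻ y, φ (Y ω, y) * gammaPDF 1 c (y - recordValue X (m + 1) ω)) ∂P := by
    intro m hY φ hφ
    have := setLIntegral_recordEvent_succ hX hindep hc hν hY hφ
    rwa [Measure.restrict_eq_self_of_ae_mem (ae_recordEvent hX hindep hc hν (m + 1)),
      Measure.restrict_eq_self_of_ae_mem (ae_recordEvent hX hindep hc hν m)] at this
  induction j, hj using Nat.le_induction generalizing φ with
  | base => simpa using one hY hφ
  | succ j hj ih =>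
    have h1 := one (hY.mono j) hφ
    rw [show m + j + 1 + 1 = m + 1 + (j + 1) by ring, show m + j + 1 = m + 1 + j by ring] at h1
    rw [h1, ih (measurable_lintegral_gammaPDF hφ 1)]
    refine lintegral_congr fun ω => ?_
    generalize recordValue X (m + 1) ω = x
    generalize Y ω = a
    have hφa : Measurable fun z => φ (a, z) := hφ.comp measurable_prodMk_left
    have hj' : (1 : ℝ) ≤ j := by exact_mod_cast hj
    have : ∀ y, (∫⁻ z, φ (a, z) * gammaPDF 1 c (z - y)) * gammaPDF j c (y - x) =
        ∫⁻ z, φ (a, z) * (gammaPDF j c (y - x) * gammaPDF 1 c (z - y)) := fun _ =>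
      lintegral_mul_mul_gammaPDF _ _ _ _ _
    simp_rw [this]
    -- After Tonelli the inner integral is the convolution of Gamma shapes `j` and 1, which is Gamma
    -- of shape `j + 1`.
    rw [lintegral_lintegral_swap (by fun_prop)]
    refine lintegral_congr fun z => ?_
    rw [lintegral_const_mul _ (by fun_prop),
      lintegral_gammaPDF_mul_gammaPDF (by linarith) one_pos (by linarith) hc]
    push_cast
    rfl

/-- The left side is computed by an increment over `k` records followed by one over `r`, the right
side by a single increment over `k + r`. With the lower record fixed at `u` and the upper at `v`,
they agree by the beta-gamma identity. -/
theorem lintegral_recordValue_between (hX : ∀ i, Measurable (X i))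
    (hindep : iIndepFun X P) (hc : 0 < c)
    (hν : ∀ i, P.map (X i) = volume.withDensity (fun y => gammaPDF 1 c (y - l))) (m : ℕ)
    {k r : ℕ} (hk : 1 ≤ k) (hr : 1 ≤ r) {φ : (ℝ × ℝ) × ℝ → ENNReal} (hφ : Measurable φ) :
    ∫⁻ ω, φ ((recordValue X (m + 1) ω, recordValue X (m + 1 + k + r) ω),
        recordValue X (m + 1 + k) ω) ∂P =
      ∫⁻ ω, ∫⁻ s, φ ((recordValue X (m + 1) ω, recordValue X (m + 1 + k + r) ω),
        recordValue X (m + 1) ω +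
          (recordValue X (m + 1 + k + r) ω - recordValue X (m + 1) ω) * s)
        ∂(betaMeasure k r) ∂P := by
  have hk' : (1 : ℝ) ≤ k := by exact_mod_cast hk
  have hr' : (1 : ℝ) ≤ r := by exact_mod_cast hr
  have := isProbabilityMeasureBeta (α := k) (β := r) (by linarith) (by linarith)
  have hR := isRecordPast_recordValue hX m
  have hR2 : IsRecordPast hX (m + k) (fun ω => (recordValue X (m + 1) ω,
      recordValue X (m + 1 + k) ω)) := by
    have := isRecordPast_recordValue hX (m + k)
    rw [show m + k + 1 = m + 1 + k by ring] at this
    exact (hR.mono k).prodMk this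
  have h1 := lintegral_recordValue_add hX hindep hc hν hR2 hr
    (φ := fun p : (ℝ × ℝ) × ℝ => φ ((p.1.1, p.2), p.1.2)) (by fun_prop)
  rw [show m + k + 1 = m + 1 + k by ring] at h1
  have h2 := lintegral_recordValue_add hX hindep hc hν hR hk
    (φ := fun p : ℝ × ℝ => ∫⁻ y, φ ((p.1, y), p.2) * gammaPDF r c (y - p.2))
    (measurable_lintegral_gammaPDF (α := ℝ × ℝ) (φ := fun q => φ ((q.1.1, q.2), q.1.2))
      (by fun_prop) r |>.comp (measurable_id.prodMk measurable_snd))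
  have hψ : Measurable fun p : ℝ × ℝ =>
      ∫⁻ s, φ ((p.1, p.2), p.1 + (p.2 - p.1) * s) ∂(betaMeasure k r) :=
    Measurable.lintegral_prod_right' (f := fun q : (ℝ × ℝ) × ℝ =>
      φ ((q.1.1, q.1.2), q.1.1 + (q.1.2 - q.1.1) * q.2)) (by fun_prop)
  have h3 := lintegral_recordValue_add hX hindep hc hν hR (show 1 ≤ k + r by omega) hψ
  rw [← add_assoc] at h3
  rw [h1, h2, h3]
  refine lintegral_congr fun ω => ?_
  generalize recordValue X (m + 1) ω = u
  have : ∀ t, (∫⁻ v, φ ((u, v), t) * gammaPDF r c (v - t)) * gammaPDF k c (t - u) =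
        ∫⁻ v, φ ((u, v), t) * (gammaPDF k c (t - u) * gammaPDF r c (v - t)) := fun _ =>
    lintegral_mul_mul_gammaPDF _ _ _ _ _
  simp_rw [this]
  rw [lintegral_lintegral_swap (by fun_prop)]
  refine lintegral_congr fun v => ?_
  rw [lintegral_mul_gammaPDF_mul_gammaPDF (by linarith) (by linarith) (by linarith) hc u v
    (fun t => φ ((u, v), t)) (by fun_prop), mul_comm]
  push_cast
  rfl

/-- A record value minus the left extremity is Gamma distributed. -/
theorem lintegral_recordValue (hX : ∀ i, Measurable (X i)) (hindep : iIndepFun X P) (hc : 0 < c)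
    (hν : ∀ i, P.map (X i) = volume.withDensity (fun y => gammaPDF 1 c (y - l))) (m : ℕ)
    {φ : ℝ → ENNReal} (hφ : Measurable φ) :
    ∫⁻ ω, φ (recordValue X (m + 1) ω) ∂P = ∫⁻ y, φ y * gammaPDF (m + 1 : ℕ) c (y - l) := by
  have h0 : ∀ {φ : ℝ → ENNReal}, Measurable φ →
      ∫⁻ ω, φ (recordValue X (0 + 1) ω) ∂P = ∫⁻ y, φ y * gammaPDF 1 c (y - l) := by
    intro φ hφ
    have : ∫⁻ y, φ y ∂(P.map (X 0)) = ∫⁻ ω, φ (recordValue X 1 ω) ∂P :=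
      lintegral_map hφ (hX 0)
    rw [zero_add, ← this, hν, lintegral_withDensity_eq_lintegral_mul _ (by fun_prop) hφ]
    exact lintegral_congr fun y => mul_comm _ _
  rcases Nat.eq_zero_or_pos m with rfl | hm
  · simpa using h0 hφ
  have hm' : (1 : ℝ) ≤ m := by exact_mod_cast hm
  have h1 := lintegral_recordValue_add hX hindep hc hν (IsRecordPast.const hX 0 ()) hm
    (φ := fun p => φ p.2) (by fun_prop)
  have hψ : Measurable fun x => ∫⁻ y, φ y * gammaPDF m c (y - x) :=
    (measurable_lintegral_gammaPDF (α := Unit) (φ := fun p => φ p.2) (by fun_prop) m).comp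
      (measurable_const.prodMk measurable_id : Measurable fun x : ℝ => ((), x))
  rw [show 0 + 1 + m = m + 1 by ring, h0 hψ] at h1
  rw [h1]
  have : ∀ x, (∫⁻ y, φ y * gammaPDF m c (y - x)) * gammaPDF 1 c (x - l) =
        ∫⁻ y, φ y * (gammaPDF 1 c (x - l) * gammaPDF m c (y - x)) := fun _ =>
    lintegral_mul_mul_gammaPDF _ _ _ _ _
  simp_rw [this]
  rw [lintegral_lintegral_swap (by fun_prop)]
  refine lintegral_congr fun z => ?_
  rw [lintegral_const_mul _ (by fun_prop),
    lintegral_gammaPDF_mul_gammaPDF one_pos (by linarith) (by linarith) hc, add_comm (1 : ℝ)]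
  push_cast
  rfl

end

/-! ### Derivatives of the divided difference as weighted integrals -/

/-- Differentiation under the integral sign for `f` of class `C¹` on `(l, ∞)`. -/
theorem hasDerivAt_integral_comp_affine {f f' : ℝ → ℝ} {l : ℝ}
    (hf : ∀ x, l < x → HasDerivAt f (f' x) x) (hf' : ContinuousOn f' (Set.Ioi l))
    {p q w : ℝ → ℝ} (hp : Continuous p) (hq : Continuous q) (hw : Continuous w) {x₀ : ℝ}
    (hx₀ : ∀ s ∈ Set.Icc (0 : ℝ) 1, l < p s + x₀ * q s) :
    HasDerivAt (fun x => ∫ s in (0 : ℝ)..1, f (p s + x * q s) * w s)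
      (∫ s in (0 : ℝ)..1, f' (p s + x₀ * q s) * (q s * w s)) x₀ := by
  have hfc : ContinuousOn f (Set.Ioi l) := fun x hx => (hf x hx).continuousAt.continuousWithinAt
  have hopen : IsOpen {z : ℝ × ℝ | l < p z.2 + z.1 * q z.2} :=
    isOpen_lt continuous_const (by fun_prop)
  -- The tube lemma gives one neighbourhood of `x₀` on which the argument of `f` stays above `l` for
  -- all `s` in `[0, 1]`; compactness then supplies a constant dominating bound.
  obtain ⟨U, V, hU, -, hxU, hV, hUV⟩ := generalized_tube_lemma (isCompact_singleton (x := x₀))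
    (isCompact_Icc (a := (0 : ℝ)) (b := 1)) hopen (by
      rintro ⟨x, s⟩ ⟨hx, hs⟩
      obtain rfl : x = x₀ := hx
      exact hx₀ s hs)
  obtain ⟨ε, hε, hball⟩ := Metric.nhds_basis_closedBall.mem_iff.1
    (hU.mem_nhds (hxU (Set.mem_singleton x₀)))
  have hmem : ∀ x ∈ Metric.closedBall x₀ ε, ∀ s ∈ Set.Icc (0 : ℝ) 1, l < p s + x * q s :=
    fun x hx s hs => hUV (Set.mk_mem_prod (hball hx) (hV hs))
  have hcont : ∀ {g : ℝ → ℝ}, ContinuousOn g (Set.Ioi l) → ∀ {w : ℝ → ℝ}, Continuous w →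
      ∀ x ∈ Metric.closedBall x₀ ε,
      ContinuousOn (fun s => g (p s + x * q s) * w s) (Set.Icc 0 1) := by
    intro g hg w hw x hx
    refine ContinuousOn.mul (hg.comp (by fun_prop) fun s hs => hmem x hx s hs) hw.continuousOn
  have hsm : ∀ {g : ℝ → ℝ}, ContinuousOn g (Set.Ioi l) → ∀ {w : ℝ → ℝ}, Continuous w →
      ∀ x ∈ Metric.closedBall x₀ ε,
      IntervalIntegrable (fun s => g (p s + x * q s) * w s) volume 0 1 := by
    intro g hg w hw x hx
    refine ContinuousOn.intervalIntegrable ?_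
    rw [Set.uIcc_of_le zero_le_one]
    exact hcont hg hw x hx
  obtain ⟨C, hC⟩ := ((isCompact_closedBall x₀ ε).prod
    (isCompact_Icc (a := (0 : ℝ)) (b := 1))).exists_bound_of_continuousOn
    (f := fun z : ℝ × ℝ => f' (p z.2 + z.1 * q z.2) * (q z.2 * w z.2))
    (ContinuousOn.mul (hf'.comp (by fun_prop) fun z hz => hmem z.1 hz.1 z.2 hz.2) (by fun_prop))
  have hxb : x₀ ∈ Metric.closedBall x₀ ε := Metric.mem_closedBall_self hε.le
  refine (intervalIntegral.hasDerivAt_integral_of_dominated_loc_of_deriv_le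
    (F := fun x s => f (p s + x * q s) * w s)
    (F' := fun x s => f' (p s + x * q s) * (q s * w s)) (bound := fun _ => C)
    (Metric.closedBall_mem_nhds x₀ hε) ?_ (hsm hfc hw x₀ hxb) ?_ ?_ ?_ ?_).2
  · filter_upwards [Metric.closedBall_mem_nhds x₀ hε] with x hx
    have := (hsm hfc hw x hx).aestronglyMeasurable
    rwa [Set.uIoc_of_le zero_le_one]
  · have := (hsm hf' (hq.mul hw) x₀ hxb).aestronglyMeasurable
    rwa [Set.uIoc_of_le zero_le_one]
  · refine Filter.Eventually.of_forall fun s hs x hx => ?_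
    rw [Set.uIoc_of_le zero_le_one] at hs
    exact hC (x, s) ⟨hx, Set.Ioc_subset_Icc_self hs⟩
  · exact intervalIntegrable_const
  · refine Filter.Eventually.of_forall fun s hs x hx => ?_
    rw [Set.uIoc_of_le zero_le_one] at hs
    have h1 := hf _ (hmem x hx s (Set.Ioc_subset_Icc_self hs))
    have h2 : HasDerivAt (fun x => p s + x * q s) (q s) x := by
      simpa using ((hasDerivAt_id x).mul_const (q s)).const_add (p s)
    have := (h1.comp x h2).mul_const (w s)
    rwa [mul_assoc] at this

section
variable {h : ℝ → ℝ} {l : ℝ} {m : ℕ}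

theorem continuousOn_iteratedDeriv_Ioi (hh : ContDiffOn ℝ m h (Set.Ioi l)) {j : ℕ} (hj : j ≤ m) :
    ContinuousOn (iteratedDeriv j h) (Set.Ioi l) :=
  (hh.continuousOn_iteratedDerivWithin (by exact_mod_cast hj) (uniqueDiffOn_Ioi l)).congr
    fun _ hx => (iteratedDerivWithin_of_isOpen isOpen_Ioi hx).symm

theorem hasDerivAt_iteratedDeriv_Ioi (hh : ContDiffOn ℝ m h (Set.Ioi l)) {j : ℕ} (hj : j < m)
    {x : ℝ} (hx : l < x) : HasDerivAt (iteratedDeriv j h) (iteratedDeriv (j + 1) h x) x := by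
  have h1 : DifferentiableAt ℝ (iteratedDeriv j h) x :=
    ((hh.differentiableOn_iteratedDerivWithin (by exact_mod_cast hj) (uniqueDiffOn_Ioi l)).congr
      fun _ hx => (iteratedDerivWithin_of_isOpen isOpen_Ioi hx).symm).differentiableAt
      (isOpen_Ioi.mem_nhds hx)
  rw [iteratedDeriv_succ]
  exact h1.hasDerivAt

theorem dividedDiff_eq_integral (hh : ContDiffOn ℝ m h (Set.Ioi l)) (hm : 1 ≤ m) {u v : ℝ}
    (hu : l < u) (huv : u < v) :
    dividedDiff h u v = ∫ s in (0 : ℝ)..1, iteratedDeriv 1 h (u + (v - u) * s) := by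
  have hmem : ∀ s ∈ Set.uIcc (0 : ℝ) 1, l < u + (v - u) * s := by
    intro s hs
    rw [Set.uIcc_of_le zero_le_one] at hs
    nlinarith [hs.1]
  have hd : ∀ s ∈ Set.uIcc (0 : ℝ) 1, HasDerivAt (fun s => h (u + (v - u) * s))
      (iteratedDeriv 1 h (u + (v - u) * s) * (v - u)) s := by
    intro s hs
    have h1 := hasDerivAt_iteratedDeriv_Ioi hh (show 0 < m by omega) (hmem s hs)
    rw [iteratedDeriv_zero] at h1
    have h2 : HasDerivAt (fun s => u + (v - u) * s) (v - u) s := by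
      simpa using ((hasDerivAt_id s).const_mul (v - u)).const_add u
    exact h1.comp s h2
  have hint := intervalIntegral.integral_eq_sub_of_hasDerivAt hd
    (ContinuousOn.intervalIntegrable (((continuousOn_iteratedDeriv_Ioi hh hm).comp (by fun_prop)
      hmem).mul continuousOn_const))
  rw [intervalIntegral.integral_mul_const] at hint
  have : v - u ≠ 0 := by linarith
  rw [dividedDiff, div_eq_iff this, hint]
  simp

theorem iteratedDeriv_dividedDiff (hh : ContDiffOn ℝ m h (Set.Ioi l)) {j : ℕ} (hj : j + 1 ≤ m)
    {u v : ℝ} (hu : l < u) (huv : u < v) :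
    iteratedDeriv j (fun v' => dividedDiff h u v') v =
      ∫ s in (0 : ℝ)..1, iteratedDeriv (j + 1) h (u + (v - u) * s) * s ^ j := by
  induction j generalizing v with
  | zero => simpa using dividedDiff_eq_integral hh hj hu huv
  | succ j ih =>
    have heq : iteratedDeriv j (fun v' => dividedDiff h u v') =ᶠ[nhds v] fun v' =>
        ∫ s in (0 : ℝ)..1, iteratedDeriv (j + 1) h ((u - u * s) + v' * s) * s ^ j := by
      filter_upwards [lt_mem_nhds huv] with v' hv'
      rw [ih (by omega) hv']
      simp_rw [show ∀ s, u + (v' - u) * s = (u - u * s) + v' * s from fun s => by ring]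
    rw [iteratedDeriv_succ, heq.deriv_eq,
      (hasDerivAt_integral_comp_affine (l := l) (q := fun s => s)
      (fun x hx => hasDerivAt_iteratedDeriv_Ioi hh (show j + 1 < m by omega) hx)
      (continuousOn_iteratedDeriv_Ioi hh hj) (by fun_prop) (by fun_prop) (by fun_prop)
      (fun s hs => by nlinarith [hs.1, hs.2])).deriv]
    refine intervalIntegral.integral_congr fun s _ => ?_
    rw [show u + (v - u) * s = (u - u * s) + v * s by ring, pow_succ' s j]

/-- Since `u + (v - u) s = (1 - s) u + s v`, each derivative in `u` brings out `1 - s`, just as each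
derivative in `v` brought out `s`. -/
theorem dividedDiffDeriv_eq_integral (hh : ContDiffOn ℝ m h (Set.Ioi l)) {i j : ℕ}
    (hij : i + j + 1 ≤ m) {u v : ℝ} (hu : l < u) (huv : u < v) :
    dividedDiffDeriv h i j u v =
      ∫ s in (0 : ℝ)..1,
        iteratedDeriv (i + j + 1) h (u + (v - u) * s) * ((1 - s) ^ i * s ^ j) := by
  unfold dividedDiffDeriv
  induction i generalizing u with
  | zero => simpa using iteratedDeriv_dividedDiff hh (by omega) hu huv
  | succ i ih =>
    have heq : iteratedDeriv i (fun u' => iteratedDeriv j (fun v' => dividedDiff h u' v') v)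
        =ᶠ[nhds u] fun u' => ∫ s in (0 : ℝ)..1,
          iteratedDeriv (i + j + 1) h (v * s + u' * (1 - s)) * ((1 - s) ^ i * s ^ j) := by
      filter_upwards [lt_mem_nhds hu, gt_mem_nhds huv] with u' hu' huv'
      rw [ih (by omega) hu' huv']
      simp_rw [show ∀ s, u' + (v - u') * s = v * s + u' * (1 - s) from fun s => by ring]
    rw [iteratedDeriv_succ, heq.deriv_eq,
      (hasDerivAt_integral_comp_affine (l := l) (p := fun s => v * s) (q := fun s => 1 - s)
      (fun x hx => hasDerivAt_iteratedDeriv_Ioi hh (show i + j + 1 < m by omega) hx)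
      (continuousOn_iteratedDeriv_Ioi hh (by omega)) (by fun_prop) (by fun_prop) (by fun_prop)
      (fun s hs => by nlinarith [hs.1, hs.2])).deriv]
    refine intervalIntegral.integral_congr fun s _ => ?_
    rw [show u + (v - u) * s = v * s + u * (1 - s) by ring, pow_succ' (1 - s) i,
      show i + j + 1 + 1 = i + 1 + j + 1 by ring]
    ring
end

/-! ### Beta laws with integer parameters and the affine kernel -/

theorem betaMeasure_natCast_succ (k r : ℕ) :
    betaMeasure (k + 1 : ℕ) (r + 1 : ℕ) =
      (volume.restrict (Set.Ioc 0 1)).withDensity fun s : ℝ =>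
        ENNReal.ofReal (((k + r + 1).factorial : ℝ) / (k.factorial * r.factorial) *
          ((1 - s) ^ r * s ^ k)) := by
  rw [betaMeasure, ← withDensity_indicator measurableSet_Ioc]
  refine withDensity_congr_ae ?_
  -- At `s = 1` with `r = 0` the polynomial weight is nonzero but `betaPDF` is 0.
  filter_upwards [Measure.ae_ne volume 1] with s hs
  by_cases h : s ∈ Set.Ioc (0 : ℝ) 1
  · have h1 : s < 1 := lt_of_le_of_ne h.2 hs
    rw [Set.indicator_of_mem h, betaPDF_of_pos_lt_one h.1 h1, beta]
    push_cast
    rw [add_sub_cancel_right, add_sub_cancel_right, Real.rpow_natCast, Real.rpow_natCast,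
      Real.Gamma_nat_eq_factorial, Real.Gamma_nat_eq_factorial,
      show (k + 1 + (r + 1) : ℝ) = (k + r + 1 : ℕ) + 1 by push_cast; ring,
      Real.Gamma_nat_eq_factorial, one_div_div]
    congr 1
    ring
  · rw [Set.indicator_of_notMem h]
    rcases not_and_or.1 h with h0 | h0
    · exact betaPDF_eq_zero_of_nonpos (not_lt.1 h0)
    · exact betaPDF_eq_zero_of_one_le (not_le.1 h0).le

theorem integral_betaMeasure (k r : ℕ) (g : ℝ → ℝ) :
    ∫ s, g s ∂(betaMeasure (k + 1 : ℕ) (r + 1 : ℕ)) =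
      ((k + r + 1).factorial : ℝ) / (k.factorial * r.factorial) *
        ∫ s in (0 : ℝ)..1, g s * ((1 - s) ^ r * s ^ k) := by
  rw [betaMeasure_natCast_succ, integral_withDensity_eq_integral_toReal_smul (by fun_prop)
    (Filter.Eventually.of_forall fun _ => ENNReal.ofReal_lt_top),
    intervalIntegral.integral_of_le zero_le_one, ← integral_const_mul]
  refine setIntegral_congr_fun measurableSet_Ioc fun s hs => ?_
  have h1 : 0 ≤ 1 - s := by linarith [hs.2]
  have h0 : 0 ≤ s := hs.1.le
  simp only [smul_eq_mul]
  rw [ENNReal.toReal_ofReal (by positivity)]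
  ring

theorem integrable_betaMeasure (k r : ℕ) {g : ℝ → ℝ} (hg : ContinuousOn g (Set.Icc 0 1)) :
    Integrable g (betaMeasure (k + 1 : ℕ) (r + 1 : ℕ)) := by
  rw [betaMeasure_natCast_succ, integrable_withDensity_iff_integrable_smul' (by fun_prop)
    (Filter.Eventually.of_forall fun _ => ENNReal.ofReal_lt_top)]
  have : IntegrableOn (fun s => (((k + r + 1).factorial : ℝ) / (k.factorial * r.factorial) *
          ((1 - s) ^ r * s ^ k)) * g s) (Set.Ioc 0 1) :=
    (ContinuousOn.integrableOn_Icc (ContinuousOn.mul (by fun_prop) hg)).mono_set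
      Set.Ioc_subset_Icc_self
  refine this.congr_fun (fun s hs => ?_) measurableSet_Ioc
  have h1 : 0 ≤ 1 - s := by linarith [hs.2]
  have h0 : 0 ≤ s := hs.1.le
  simp only [smul_eq_mul]
  rw [ENNReal.toReal_ofReal (by positivity)]

theorem measurable_affine_between :
    Measurable fun p : (ℝ × ℝ) × ℝ => p.1.1 + (p.1.2 - p.1.1) * p.2 := by fun_prop

/-- The kernel sending `(u, v)` to the law of `u + (v - u) S`, where `S` has law `β`. -/
noncomputable def affineKernel (β : Measure ℝ) [SFinite β] : Kernel (ℝ × ℝ) ℝ where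
  toFun z := β.map fun s => z.1 + (z.2 - z.1) * s
  measurable' := by
    refine Measure.measurable_of_measurable_coe _ fun s hs => ?_
    have : ∀ z : ℝ × ℝ, β.map (fun s => z.1 + (z.2 - z.1) * s) s =
        β (Prod.mk z ⁻¹' ((fun p : (ℝ × ℝ) × ℝ => p.1.1 + (p.1.2 - p.1.1) * p.2) ⁻¹' s)) :=
      fun z => Measure.map_apply (by fun_prop) hs
    simp_rw [this]
    exact measurable_measure_prodMk_left (measurable_affine_between hs)

theorem affineKernel_apply (β : Measure ℝ) [SFinite β] (z : ℝ × ℝ) :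
    affineKernel β z = β.map fun s => z.1 + (z.2 - z.1) * s := rfl

instance (β : Measure ℝ) [IsProbabilityMeasure β] : IsMarkovKernel (affineKernel β) :=
  ⟨fun z => by
    rw [affineKernel_apply]
    exact Measure.isProbabilityMeasure_map (by fun_prop)⟩

theorem continuous_integral_affineKernel (β : Measure ℝ) [IsProbabilityMeasure β]
    (g : BoundedContinuousFunction ℝ ℝ) : Continuous fun z => ∫ y, g y ∂(affineKernel β z) := by
  have : ∀ z : ℝ × ℝ, ∫ y, g y ∂(affineKernel β z) = ∫ s, g (z.1 + (z.2 - z.1) * s) ∂β := by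
    intro z
    rw [affineKernel_apply, integral_map (by fun_prop) g.continuous.aestronglyMeasurable]
  simp_rw [this]
  refine continuous_of_dominated (bound := fun _ => ‖g‖)
    (fun z => (g.continuous.comp (by fun_prop)).aestronglyMeasurable)
    (fun z => Filter.Eventually.of_forall fun s => g.norm_coe_le_norm _) (integrable_const _)
    (Filter.Eventually.of_forall fun s => g.continuous.comp (by fun_prop))

/-- An embedding transports integrals without measurability of the integrand, and the derivative of
`h` is controlled only on `(l, ∞)`. -/
theorem measurableEmbedding_affine {u v : ℝ} (huv : u < v) :
    MeasurableEmbedding fun s => u + (v - u) * s := by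
  refine Continuous.measurableEmbedding (by fun_prop) fun s t hst => ?_
  have : v - u ≠ 0 := by linarith
  exact mul_left_cancel₀ this (add_left_cancel hst)

/-! ### The conditional distribution and its uniqueness -/

section
variable {Ω : Type*} [MeasurableSpace Ω] {P : Measure Ω} [IsProbabilityMeasure P]
  {X : ℕ → Ω → ℝ} {l c : ℝ}

theorem isContinuousCondDistribOn_affineKernel (hX : ∀ i, Measurable (X i))
    (hindep : iIndepFun X P) (hc : 0 < c)
    (hν : ∀ i, P.map (X i) = volume.withDensity (fun y => gammaPDF 1 c (y - l))) (m : ℕ)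
    {k r : ℕ} (hk : 1 ≤ k) (hr : 1 ≤ r) [IsProbabilityMeasure (betaMeasure k r)]
    (U : Set (ℝ × ℝ)) :
    IsContinuousCondDistribOn (recordValue X (m + 1 + k))
      (fun ω => (recordValue X (m + 1) ω, recordValue X (m + 1 + k + r) ω))
      (affineKernel (betaMeasure k r)) U P where
  isMarkovKernel := inferInstance
  continuousOn g := (continuous_integral_affineKernel _ g).continuousOn
  hasCondDistrib := by
    have hae : ∀ j, AEMeasurable (recordValue X (m + 1 + j)) P := fun j => by
      simpa [add_right_comm] using aemeasurable_recordValue hX hindep hc hν (m + j)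
    have ha : AEMeasurable (recordValue X (m + 1)) P := hae 0
    have hb := hae k
    have hd := hae (k + r)
    rw [← add_assoc] at hd
    refine ⟨by fun_prop, ?_⟩
    ext S hS
    have hφ : Measurable (S.indicator (1 : (ℝ × ℝ) × ℝ → ENNReal)) := measurable_one.indicator hS
    rw [Measure.compProd_apply hS,
      lintegral_map' (Kernel.measurable_kernel_prodMk_left hS).aemeasurable (by fun_prop),
      ← lintegral_indicator_one hS, lintegral_map' hφ.aemeasurable (by fun_prop),
      lintegral_recordValue_between hX hindep hc hν m hk hr hφ]
    refine lintegral_congr fun ω => ?_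
    rw [affineKernel_apply, Measure.map_apply (by fun_prop) (measurable_prodMk_left hS),
      ← lintegral_indicator_one ((measurable_prodMk_left hS).preimage (by fun_prop))]
    rfl

/-- The joint law of two record values charges every open subset of `{l < u < v}`. -/
theorem restrict_absolutelyContinuous_map_recordValue (hX : ∀ i, Measurable (X i))
    (hindep : iIndepFun X P) (hc : 0 < c)
    (hν : ∀ i, P.map (X i) = volume.withDensity (fun y => gammaPDF 1 c (y - l))) (m : ℕ)
    {j : ℕ} (hj : 1 ≤ j) :
    (volume.restrict {z : ℝ × ℝ | l < z.1 ∧ z.1 < z.2}) ≪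
      P.map fun ω => (recordValue X (m + 1) ω, recordValue X (m + 1 + j) ω) := by
  have ha : AEMeasurable (recordValue X (m + 1)) P := aemeasurable_recordValue hX hindep hc hν m
  have hb : AEMeasurable (recordValue X (m + 1 + j)) P := by
    simpa [add_right_comm] using aemeasurable_recordValue hX hindep hc hν (m + j)
  have hj' : (1 : ℝ) ≤ j := by exact_mod_cast hj
  refine Measure.AbsolutelyContinuous.mk fun S hS h0 => ?_
  have hφ : Measurable (S.indicator (1 : ℝ × ℝ → ENNReal)) := measurable_one.indicator hS
  rw [← lintegral_indicator_one hS, lintegral_map' hφ.aemeasurable (by fun_prop),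
    lintegral_recordValue_add hX hindep hc hν (isRecordPast_recordValue hX m) hj hφ] at h0
  have h1 := lintegral_recordValue hX hindep hc hν m
    ((measurable_lintegral_gammaPDF (c := c) hφ j).comp
      (measurable_id.prodMk measurable_id : Measurable fun x : ℝ => (x, x)))
  -- The joint density is a product of two Gamma densities, both positive where `l < u < v`; a null
  -- set for the joint law is therefore Lebesgue null there.
  have h2 : ∫⁻ z : ℝ × ℝ, S.indicator 1 z * (gammaPDF j c (z.2 - z.1) *
      gammaPDF (m + 1 : ℕ) c (z.1 - l)) = 0 := by
    rw [Measure.volume_eq_prod, lintegral_prod _ (by fun_prop), ← h0]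
    refine Eq.trans ?_ h1.symm
    refine lintegral_congr fun u => ?_
    simp_rw [← mul_assoc]
    exact lintegral_mul_const' _ _ ENNReal.ofReal_ne_top
  rw [lintegral_eq_zero_iff (by fun_prop)] at h2
  have hU : MeasurableSet {z : ℝ × ℝ | l < z.1 ∧ z.1 < z.2} :=
    (measurableSet_lt measurable_const measurable_fst).inter
      (measurableSet_lt measurable_fst measurable_snd)
  rw [← compl_mem_ae_iff, ← Filter.eventually_mem_set, ae_restrict_iff' hU]
  filter_upwards [h2] with z hz hzU hzS
  have hm' : (0 : ℝ) < (m + 1 : ℕ) := by positivity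
  have e1 : gammaPDF j c (z.2 - z.1) ≠ 0 := by
    rw [gammaPDF, ne_eq, ENNReal.ofReal_eq_zero, not_le]
    exact gammaPDFReal_pos (by linarith) hc (by linarith [hzU.2])
  have e2 : gammaPDF (m + 1 : ℕ) c (z.1 - l) ≠ 0 := by
    rw [gammaPDF, ne_eq, ENNReal.ofReal_eq_zero, not_le]
    exact gammaPDFReal_pos hm' hc (by linarith [hzU.1])
  rw [Set.indicator_of_mem hzS, Pi.one_apply, one_mul] at hz
  exact mul_ne_zero e1 e2 hz

/-- Two versions agree almost everywhere for the law of `Z`, hence Lebesgue almost everywhere on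
`U`. Integrals of bounded continuous functions are continuous on the open set `U`, so they agree
everywhere on it, and they determine the measures. -/
theorem IsContinuousCondDistribOn.apply_eq {Y : Ω → ℝ} {Z : Ω → ℝ × ℝ}
    {κ η : Kernel (ℝ × ℝ) ℝ} {U : Set (ℝ × ℝ)} (hκ : IsContinuousCondDistribOn Y Z κ U P)
    (hη : IsContinuousCondDistribOn Y Z η U P) (hU : IsOpen U)
    (hZ : volume.restrict U ≪ P.map Z) {z : ℝ × ℝ} (hz : z ∈ U) : κ z = η z := by
  have := hκ.isMarkovKernel
  have := hη.isMarkovKernel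
  have : IsProbabilityMeasure (P.map Z) :=
    Measure.isProbabilityMeasure_map hκ.hasCondDistrib.aemeasurable_fst
  have hae : κ =ᵐ[P.map Z] η := Kernel.ae_eq_of_compProd_eq
    (hκ.hasCondDistrib.map_eq.symm.trans hη.hasCondDistrib.map_eq)
  refine ext_of_forall_integral_eq_of_IsFiniteMeasure fun g => ?_
  refine Measure.eqOn_open_of_ae_eq (μ := volume) (f := fun z => ∫ y, g y ∂(κ z))
    (g := fun z => ∫ y, g y ∂(η z)) ?_ hU (hκ.continuousOn g) (hη.continuousOn g) hz
  filter_upwards [hZ.ae_le hae] with z hz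
  simp only [hz]

end

theorem lemma2 {Ω : Type*} [MeasurableSpace Ω] (P : Measure Ω) [IsProbabilityMeasure P]
    (X : ℕ → Ω → ℝ) (hX : ∀ i, Measurable (X i)) (hindep : iIndepFun X P)
    (F : ℝ → ℝ) (hF : ∀ i x, cdf (P.map (X i)) x = F x)
    (l c : ℝ) (hc : 0 < c)
    (hl : leftExtremity F = (l : EReal)) (hr : rightExtremity F = ⊤)
    (hexp : ∀ x, l ≤ x → F x = 1 - Real.exp (-c * (x - l)))
    (n k r : ℕ) (hk : 1 ≤ k) (hkn : k < n) (hr1 : 1 ≤ r)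
    (h : ℝ → ℝ) (hcont : ContinuousOn h (Set.Ici l))
    (hdiff : ContDiffOn ℝ (k + r - 1 : ℕ) h (Set.Ioi l)) :
    (∃ κ : Kernel (ℝ × ℝ) ℝ,
      IsContinuousCondDistribOn (recordValue X n)
        (fun ω => (recordValue X (n - k) ω, recordValue X (n + r) ω)) κ
        {z | l < z.1 ∧ z.1 < z.2} P) ∧
    ∀ κ : Kernel (ℝ × ℝ) ℝ,
      IsContinuousCondDistribOn (recordValue X n)
        (fun ω => (recordValue X (n - k) ω, recordValue X (n + r) ω)) κ
        {z | l < z.1 ∧ z.1 < z.2} P →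
      ∀ u v : ℝ, l < u → u < v →
        Integrable (iteratedDeriv (k + r - 1) h) (κ (u, v)) ∧
        ∫ t, iteratedDeriv (k + r - 1) h t ∂(κ (u, v)) =
          ((k + r - 1).factorial : ℝ) / ((k - 1).factorial * (r - 1).factorial) *
            dividedDiffDeriv h (r - 1) (k - 1) u v := by

  have hν : ∀ i, P.map (X i) = volume.withDensity (fun y => gammaPDF 1 c (y - l)) := by
    intro i
    have := Measure.isProbabilityMeasure_map (μ := P) (hX i).aemeasurable
    exact eq_withDensity_of_cdf_eq hc fun x hx => by rw [hF, hexp x hx]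
  -- `n - k` becomes `m + 1`, a genuine record number; shifting `k` and `r` by one then removes the
  -- truncated subtractions.
  obtain ⟨m, rfl⟩ : ∃ m, n = m + 1 + k := ⟨n - k - 1, by omega⟩
  obtain ⟨k, rfl⟩ : ∃ k', k = k' + 1 := ⟨k - 1, by omega⟩
  obtain ⟨r, rfl⟩ : ∃ r', r = r' + 1 := ⟨r - 1, by omega⟩
  simp only [Nat.add_sub_cancel]
  have hsub : k + 1 + (r + 1) - 1 = k + r + 1 := by omega
  rw [hsub] at hdiff ⊢
  have hβ : IsProbabilityMeasure (betaMeasure (k + 1 : ℕ) (r + 1 : ℕ)) :=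
    isProbabilityMeasureBeta (by positivity) (by positivity)
  have hκ₀ := isContinuousCondDistribOn_affineKernel hX hindep hc hν m hk hr1
    {z | l < z.1 ∧ z.1 < z.2}
  refine ⟨⟨_, hκ₀⟩, fun κ hκ u v hu huv => ?_⟩
  have hopen : IsOpen {z : ℝ × ℝ | l < z.1 ∧ z.1 < z.2} :=
    (isOpen_lt continuous_const continuous_fst).inter (isOpen_lt continuous_fst continuous_snd)
  have hac := restrict_absolutelyContinuous_map_recordValue hX hindep hc hν m
    (show 1 ≤ k + 1 + (r + 1) by omega)
  rw [← add_assoc (m + 1)] at hac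
  rw [hκ.apply_eq hκ₀ hopen hac (show (u, v) ∈ {z : ℝ × ℝ | l < z.1 ∧ z.1 < z.2} from ⟨hu, huv⟩),
    affineKernel_apply, (measurableEmbedding_affine huv).integrable_map_iff,
    (measurableEmbedding_affine huv).integral_map, integral_betaMeasure,
    dividedDiffDeriv_eq_integral hdiff (by omega) hu huv, add_comm r k]
  -- Integrability holds because the derivative is continuous on the compact segment `[u, v]` inside
  -- `(l, ∞)`.
  refine ⟨integrable_betaMeasure k r ?_, rfl⟩
  refine (continuousOn_iteratedDeriv_Ioi hdiff le_rfl).comp (by fun_prop) fun s hs => ?_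
  have : 0 ≤ (v - u) * s := mul_nonneg (by linarith) hs.1
  exact Set.mem_Ioi.2 (by linarith)
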